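/- For $n\ge 0$ let $\mathrm{M}(n)$ denote one of the following three complex vector spaces, the same choice being made for all sizes: all complex $n\times n$ matrices (general case), the complex symmetric $n\times n$ matrices (symmetric case), or the complex diagonal $n\times n$ matrices (diagonal case). Put $$\Sigma^{(n)}=\{A\in \mathrm{M}(n) : A \text{ has an eigenvalue of geometric multiplicity at least } 2\},$$ $$\Sigma'^{(n)}=\{A\in \mathrm{M}(n) : \operatorname{rk} A\le n-2\},\qquad \widetilde\Sigma^{(n)}=\{(A,\lambda)\in \mathrm{M}(n)\times\mathbb C : \operatorname{rk}(A-\lambda\mathbb 1)\le n-2\}.$$ An eigenvalue is strictly $k$-fold if its algebraic and geometric multiplicities are both equal to $k$; a matrix is strictly of corank $k$ if $0$ is a strictly $k$-fold eigenvalue of it. If $(A_0,\lambda_0)\in\widetilde\Sigma^{(n)}$, let $(\Sigma^{(n)},A_0;\lambda_0)$ be the image of the set germ $(\widetilde\Sigma^{(n)},(A_0,\lambda_0))$ under the germ of the projection $(A,\lambda)\mapsto A$, that is, the germ at $A_0$ of the projection of $\widetilde\Sigma^{(n)}\cap W$ for every sufficiently small neighbourhood $W$ of $(A_0,\lambda_0)$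 (this germ does not depend on $W$). An analytic isomorphism $(X,x)\cong(Y,y)$ of germs of subsets of two complex vector spaces is the germ of a biholomorphic map from a neighbourhood of $x$ onto a neighbourhood of $y$ in the ambient spaces that maps $x$ to $y$ and $X$ onto $Y$ inside these neighbourhoods. Let $k\ge 2$, let $A_0\in\Sigma^{(n)}$ have a strictly $k$-fold eigenvalue $\lambda_0$, and let $B_0\in\Sigma'^{(n)}$ be strictly of corank $k$. Then, in each of the three cases, there are analytic isomorphisms $$(\Sigma^{(n)},A_0;\lambda_0)\cong(\Sigma^{(k)}\times\mathbb C^{\delta},0),\qquad (\Sigma'^{(n)},B_0)\cong(\Sigma'^{(k)}\times\mathbb C^{\delta},0),$$ $$(\widetilde\Sigma^{(n)},(A_0,\lambda_0))\cong(\widetilde\Sigma^{(k)}\times\mathbb C^{\delta},(0,0)),$$ where $\delta=\dim \mathrm{M}(n)-\dim \mathrm{M}(k)$, that is, $\delta=n^2-k^2$ in the general case, $\delta=\binom{n+1}{2}-\binom{k+1}{2}$ in the symmetric case, and $\delta=n-k$ in the diagonal case. -/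

import Mathlib

open Topology Module

/-! ### The ambient spaces of matrices -/

/-- The three cases: general, symmetric and diagonal matrices. -/
inductive MatrixCase where
  | general
  | sym
  | diag

/-- The complex symmetric `n × n` matrices. -/
def symmMatrices (n : ℕ) : Submodule ℂ (Matrix (Fin n) (Fin n) ℂ) where
  carrier := {A | A.IsSymm}
  add_mem' := fun hA hB => hA.add hB
  zero_mem' := Matrix.isSymm_zero
  smul_mem' := fun a _ hA => hA.smul a

/-- The complex diagonal `n × n` matrices. -/
def diagMatrices (n : ℕ) : Submodule ℂ (Matrix (Fin n) (Fin n) ℂ) where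
  carrier := {A | A.IsDiag}
  add_mem' := fun hA hB => hA.add hB
  zero_mem' := Matrix.isDiag_zero
  smul_mem' := fun a _ hA => hA.smul a

/-- The ambient space of matrices in each of the three cases. -/
def ambient : MatrixCase → (n : ℕ) → Submodule ℂ (Matrix (Fin n) (Fin n) ℂ)
  | .general, _ => ⊤
  | .sym, n => symmMatrices n
  | .diag, n => diagMatrices n

/-- The difference `δ` of the dimensions of the ambient spaces of `n × n` and `k × k` matrices
(for `k ≤ n`). -/
noncomputable def familyDim (c : MatrixCase) (n k : ℕ) : ℕ :=
  finrank ℂ (ambient c n) - finrank ℂ (ambient c k)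

/-! ### The varieties -/

/-- The dimension of the eigenspace of `A` for `l` (zero if `l` is not an eigenvalue). -/
noncomputable def geomMult {n : ℕ} (A : Matrix (Fin n) (Fin n) ℂ) (l : ℂ) : ℕ :=
  finrank ℂ (End.eigenspace (Matrix.toLin' A) l)

/-- `l` is a strictly `k`-fold eigenvalue of `A`: both its algebraic and its geometric multiplicity
are equal to `k`. -/
def IsStrictEigenvalue {n : ℕ} (A : Matrix (Fin n) (Fin n) ℂ) (l : ℂ) (k : ℕ) : Prop :=
  A.charpoly.rootMultiplicity l = k ∧ geomMult A l = k

/-- The geometric degeneracy variety `Σ` in each case: the matrices with an eigenvalue of geometric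
multiplicity at least `2`. -/
def geomDegeneracy (c : MatrixCase) (n : ℕ) : Set (ambient c n) :=
  {A | ∃ l : ℂ, 2 ≤ geomMult (A : Matrix (Fin n) (Fin n) ℂ) l}

/-- The variety `Σ'` in each case: the matrices of rank at most `n - 2` (this set is empty for
`n < 2`). -/
def corankTwo (c : MatrixCase) (n : ℕ) : Set (ambient c n) :=
  {A | (A : Matrix (Fin n) (Fin n) ℂ).rank + 2 ≤ n}

/-- The lifted variety in each case: the pairs `(A, l)` such that `A - l • 1` has rank at most
`n - 2`. -/
def liftedDegeneracy (c : MatrixCase) (n : ℕ) : Set (ambient c n × ℂ) :=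
  {q | ((q.1 : Matrix (Fin n) (Fin n) ℂ) - q.2 • (1 : Matrix (Fin n) (Fin n) ℂ)).rank + 2 ≤ n}

/-! ### Germs of sets -/

/-- The germs `(X, x)` and `(Y, y)` of subsets `X ⊆ E` and `Y ⊆ F` of complex normed spaces are
analytically isomorphic: there is a biholomorphic map `φ` from an open neighbourhood of `x` onto an
open neighbourhood of `y`, with `φ x = y`, that carries `X` onto `Y` inside these neighbourhoods.
(This is an isomorphism of the germs together with their ambient spaces, so it
restricts to an isomorphism of the germs with their reduced analytic structures.) -/
def GermIso {E F : Type*} [NormedAddCommGroup E] [NormedSpace ℂ E]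
    [NormedAddCommGroup F] [NormedSpace ℂ F]
    (X : Set E) (x : E) (Y : Set F) (y : F) : Prop :=
  ∃ φ : OpenPartialHomeomorph E F,
    x ∈ φ.source ∧ φ x = y ∧
    AnalyticOnNhd ℂ φ φ.source ∧ AnalyticOnNhd ℂ φ.symm φ.target ∧
    φ.IsImage X Y

/-- `V` represents the image of the set germ `(X, x)` under the map germ of `p` at `x`: for all
sufficiently small neighbourhoods `W` of `x`, the sets `V` and `p (X ∩ W)` have the same germ at
`p x`. -/
def IsImageGerm {E F : Type*} [NormedAddCommGroup E] [NormedAddCommGroup F]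
    (p : E → F) (X : Set E) (x : E) (V : Set F) : Prop :=
  ∃ W₀ ∈ 𝓝 x, ∀ W ∈ 𝓝 x, W ⊆ W₀ → ∀ᶠ y in 𝓝 (p x), y ∈ V ↔ y ∈ p '' (X ∩ W)

/-- The image germ is unique: any two representatives agree near `p x`. -/
theorem IsImageGerm.eventually_iff {E F : Type*} [NormedAddCommGroup E] [NormedAddCommGroup F]
    {p : E → F} {X : Set E} {x : E} {V V' : Set F}
    (h : IsImageGerm p X x V) (h' : IsImageGerm p X x V') :
    ∀ᶠ y in 𝓝 (p x), y ∈ V ↔ y ∈ V' := by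
  obtain ⟨W, hW, H⟩ := h
  obtain ⟨W', hW', H'⟩ := h'
  filter_upwards [H (W ∩ W') (Filter.inter_mem hW hW') Set.inter_subset_left,
    H' (W ∩ W') (Filter.inter_mem hW hW') Set.inter_subset_right] with y h1 h2
  rw [h1, h2]

/- Spaces of matrices are normed by the supremum of the absolute values of the entries; they are
finite-dimensional, so the choice of the norm does not affect analyticity or neighbourhoods. -/
attribute [local instance] Matrix.normedAddCommGroup Matrix.normedSpace

/-- `V` represents the germ `(Σ, A₀; l₀)`, the local branch of `Σ` at `A₀` that belongs to the
eigenvalue `l₀`: the image of the germ of the lifted variety at `(A₀, l₀)` under the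
projection `(A, l) ↦ A`. -/
def IsBranch (c : MatrixCase) (n : ℕ) (A₀ : ambient c n) (l₀ : ℂ) (V : Set (ambient c n)) : Prop :=
  IsImageGerm Prod.fst (liftedDegeneracy c n) (A₀, l₀) V

/-! ### Ranks and dimensions -/

/-! Near `A₀` every matrix of the ambient space is conjugate, analytically in the matrix, to a block
diagonal one whose lower block does not affect the degeneracy. Strictness of the eigenvalue `l`
makes kernel and range of `A₀ - l` complementary, so in an adapted basis `A₀ = diag(l, D)` with `D -
l` invertible (`nonempty_blockForm`). The basis is chosen to respect the ambient space: orthonormal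
for the dot product in the symmetric case, a permutation of the standard basis in the diagonal case.

Consider `(X, Y, N) ↦ exp(N) diag(l + X, D + Y) exp(-N)`, where `N` is block off-diagonal, skew in
the symmetric case and zero in the diagonal case. Its derivative at `0` is `[N, diag(l, D)] +
diag(X, Y)`, and the commutator has off-diagonal blocks `S (D - l)` and `-(D - l) T`. Since `D - l`
is invertible, the derivative is bijective onto the ambient space (`exists_generator`,
`generator_eq_zero`), and the inverse function theorem gives a chart in which `Y` and `N` are the
`δ` free parameters.

Conjugation preserves ranks, and `D + Y - (l + μ)` stays invertible for small `Y` and `μ`. Hence the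
corank of the matrix minus `l + μ` equals that of `X - μ` (`exists_matrix_chart`). With `μ = 0` this
settles `Σ'`, with `μ` as an additional coordinate the lifted variety. For the branch of `Σ` one
also needs that all eigenvalues of `X` are small when `X` is (`norm_le_of_two_le_geomMult`). -/

theorem Submodule.finrank_prod_eq {V W : Type*} [AddCommGroup V] [Module ℂ V]
    [FiniteDimensional ℂ V] [AddCommGroup W] [Module ℂ W] [FiniteDimensional ℂ W]
    (p : Submodule ℂ V) (q : Submodule ℂ W) :
    finrank ℂ (p.prod q) = finrank ℂ p + finrank ℂ q := by
  let e : p.prod q ≃ₗ[ℂ] p × q :=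
    { toFun := fun x => (⟨x.1.1, x.2.1⟩, ⟨x.1.2, x.2.2⟩)
      map_add' := fun _ _ => rfl
      map_smul' := fun _ _ => rfl
      invFun := fun y => ⟨(y.1.1, y.2.1), y.1.2, y.2.2⟩
      left_inv := fun _ => rfl
      right_inv := fun _ => rfl }
  rw [e.finrank_eq, Module.finrank_prod]

theorem Matrix.rank_fromBlocks_diagonal {m n : Type*} [Fintype m] [Fintype n]
    (X : Matrix m m ℂ) (Y : Matrix n n ℂ) :
    (Matrix.fromBlocks X 0 0 Y).rank = X.rank + Y.rank := by
  let e := LinearEquiv.sumArrowLequivProdArrow m n ℂ ℂ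
  have h : (Matrix.fromBlocks X 0 0 Y).mulVecLin =
      (e.symm : _ →ₗ[ℂ] _) ∘ₗ (X.mulVecLin.prodMap Y.mulVecLin) ∘ₗ (e : _ →ₗ[ℂ] _) := by
    ext v i
    cases i <;> simp [e, Matrix.fromBlocks_mulVec, LinearEquiv.sumArrowLequivProdArrow,
      Equiv.sumArrowEquivProdArrow]
  unfold Matrix.rank
  rw [h, LinearMap.range_comp, LinearEquiv.finrank_map_eq e.symm, LinearMap.range_comp_of_range_eq_top,
    LinearMap.range_prodMap]
  · exact Submodule.finrank_prod_eq _ _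
  · exact e.range

theorem geomMult_add_rank {n : ℕ} (A : Matrix (Fin n) (Fin n) ℂ) (l : ℂ) :
    geomMult A l + (A - l • (1 : Matrix (Fin n) (Fin n) ℂ)).rank = n := by
  have h : (A - l • (1 : Matrix (Fin n) (Fin n) ℂ)).mulVecLin =
      Matrix.toLin' A - l • (1 : End ℂ (Fin n → ℂ)) := by
    rw [← Matrix.toLin'_apply']
    simp [Module.End.one_eq_id]
  have := LinearMap.finrank_range_add_finrank_ker
    (A - l • (1 : Matrix (Fin n) (Fin n) ℂ)).mulVecLin
  rw [Module.finrank_fin_fun] at this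
  rw [geomMult, End.eigenspace_def, ← h, Matrix.rank, add_comm]
  exact this

/-- Symmetric matrices are functions on unordered pairs of indices. -/
def symmMatricesEquiv (n : ℕ) : (Sym2 (Fin n) → ℂ) ≃ₗ[ℂ] symmMatrices n where
  toFun f := ⟨Matrix.of fun i j => f s(i, j), by
    ext i j; simp [Matrix.transpose_apply, Sym2.eq_swap]⟩
  map_add' f g := rfl
  map_smul' a f := rfl
  invFun A := Sym2.lift ⟨fun i j => A.1 i j, fun i j => (A.2.apply i j).symm⟩
  left_inv f := by
    ext s
    induction s with | h i j => rfl
  right_inv A := rfl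

/-- Diagonal matrices are functions on the index set. -/
def diagMatricesEquiv (n : ℕ) : (Fin n → ℂ) ≃ₗ[ℂ] diagMatrices n where
  toFun d := ⟨Matrix.diagonal d, Matrix.isDiag_diagonal d⟩
  map_add' f g := Subtype.ext (Matrix.diagonal_add f g).symm
  map_smul' a f := Subtype.ext (Matrix.diagonal_smul a f)
  invFun A := A.1.diag
  left_inv f := by simp
  right_inv A := Subtype.ext A.2.diagonal_diag

theorem finrank_ambient_general (n : ℕ) : finrank ℂ (ambient .general n) = n ^ 2 := by
  change finrank ℂ (⊤ : Submodule ℂ (Matrix (Fin n) (Fin n) ℂ)) = _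
  rw [finrank_top, Module.finrank_matrix]
  simp [sq]

theorem finrank_ambient_sym (n : ℕ) : finrank ℂ (ambient .sym n) = (n + 1).choose 2 := by
  change finrank ℂ (symmMatrices n) = _
  rw [← (symmMatricesEquiv n).finrank_eq, Module.finrank_fintype_fun_eq_card, Sym2.card,
    Fintype.card_fin]

theorem finrank_ambient_diag (n : ℕ) : finrank ℂ (ambient .diag n) = n := by
  change finrank ℂ (diagMatrices n) = _
  rw [← (diagMatricesEquiv n).finrank_eq, Module.finrank_fin_fun]

/-- Only an eigenvector is needed; the factor `k` comes from summing `k` products of entries in the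
sup norms. The bound forces every degenerate eigenvalue of a small `X` into a given neighbourhood of
`0`, which identifies the branch of `Σ`. -/
theorem norm_le_of_two_le_geomMult {k : ℕ} {X : Matrix (Fin k) (Fin k) ℂ} {l : ℂ}
    (h : 2 ≤ geomMult X l) : ‖l‖ ≤ k * ‖X‖ := by
  have hne : End.eigenspace (Matrix.toLin' X) l ≠ ⊥ := by
    intro h0
    rw [geomMult, h0, finrank_bot] at h
    omega
  obtain ⟨v, hv, hv0⟩ := Submodule.exists_mem_ne_zero_of_ne_bot hne
  rw [End.mem_eigenspace_iff, Matrix.toLin'_apply] at hv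
  have hpos : 0 < ‖v‖ := norm_pos_iff.2 hv0
  refine le_of_mul_le_mul_right ?_ hpos
  rw [← norm_smul, ← hv, pi_norm_le_iff_of_nonneg (by positivity)]
  intro i
  calc ‖∑ j, X i j * v j‖ ≤ ∑ j, ‖X i j * v j‖ := norm_sum_le _ _
    _ ≤ ∑ _j : Fin k, ‖X‖ * ‖v‖ := by
        refine Finset.sum_le_sum fun j _ => ?_
        rw [norm_mul]
        exact mul_le_mul (X.norm_entry_le_entrywise_sup_norm) (norm_le_pi_norm v j)
          (norm_nonneg _) (norm_nonneg _)
    _ = k * ‖X‖ * ‖v‖ := by simp [mul_assoc]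

/-! ### Analytic charts from the inverse function theorem -/

/-- The inverse is analytic at a point when the derivative at its preimage is invertible.
Invertibility is an open condition and the derivative is continuous, so the source of the local
inverse is shrunk to where it holds. -/
theorem exists_analytic_chart {E F : Type*} [NormedAddCommGroup E] [NormedSpace ℂ E]
    [FiniteDimensional ℂ E] [NormedAddCommGroup F] [NormedSpace ℂ F] [FiniteDimensional ℂ F]
    {f : E → F} {a : E} {f' : E ≃L[ℂ] F} (hf : ∀ x, AnalyticAt ℂ f x)
    (hf' : HasStrictFDerivAt f (f' : E →L[ℂ] F) a) {U : Set E} (hU : U ∈ 𝓝 a) :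
    ∃ φ : OpenPartialHomeomorph E F, a ∈ φ.source ∧ φ.source ⊆ U ∧ (φ : E → F) = f ∧
      AnalyticOnNhd ℂ φ φ.source ∧ AnalyticOnNhd ℂ φ.symm φ.target := by
  have : CompleteSpace E := FiniteDimensional.complete ℂ E
  have : CompleteSpace F := FiniteDimensional.complete ℂ F
  let ψ := hf'.toOpenPartialHomeomorph f
  have hψ : (ψ : E → F) = f := hf'.toOpenPartialHomeomorph_coe
  have ha : a ∈ ψ.source := hf'.mem_toOpenPartialHomeomorph_source
  have hcont : ContinuousAt (fderiv ℂ f) a := (hf a).fderiv.continuousAt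
  have hev : ∀ᶠ x in 𝓝 a, ∃ e : E ≃L[ℂ] F, (e : E →L[ℂ] F) = fderiv ℂ f x := by
    have h0 : fderiv ℂ f a = f' := hf'.hasFDerivAt.fderiv
    have := ContinuousLinearEquiv.nhds (𝕜 := ℂ) f'
    rw [← h0] at this
    exact hcont.eventually this
  obtain ⟨V, hVsub, hVo, haV⟩ := mem_nhds_iff.1 (Filter.inter_mem hU hev)
  refine ⟨ψ.restrOpen V hVo, ⟨ha, haV⟩, fun x hx => (hVsub hx.2).1, hψ, ?_, ?_⟩
  · intro x _
    change AnalyticAt ℂ ψ x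
    rw [hψ]
    exact hf x
  · intro y hy
    have hy' := (ψ.restrOpen V hVo).map_target hy
    obtain ⟨e, he⟩ := (hVsub hy'.2).2
    refine OpenPartialHomeomorph.analyticAt_symm (i := e) _ hy ?_ ?_
    · change AnalyticAt ℂ ψ _
      rw [hψ]
      exact hf _
    · change fderiv ℂ ψ _ = _
      rw [hψ, he]

/-! ### Block normal forms -/

/-- The ambient space of matrices indexed by an arbitrary type. -/
def ambientOn (c : MatrixCase) (ι : Type*) : Submodule ℂ (Matrix ι ι ℂ) where
  carrier := {A | match c with
    | .general => True
    | .sym => A.IsSymm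
    | .diag => A.IsDiag}
  add_mem' {A B} hA hB := by
    cases c
    · trivial
    · exact Matrix.IsSymm.add hA hB
    · exact Matrix.IsDiag.add hA hB
  zero_mem' := by
    cases c
    · trivial
    · exact Matrix.isSymm_zero
    · exact Matrix.isDiag_zero
  smul_mem' a A hA := by
    cases c
    · trivial
    · exact Matrix.IsSymm.smul hA a
    · exact Matrix.IsDiag.smul a hA

theorem ambientOn_fin (c : MatrixCase) (n : ℕ) : ambientOn c (Fin n) = ambient c n := by
  cases c
  · exact eq_top_iff.2 fun _ _ => trivial
  · rfl
  · rfl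

theorem fromBlocks_mem_ambientOn {c : MatrixCase} {m n : Type*} {X : Matrix m m ℂ}
    {Y : Matrix n n ℂ} :
    Matrix.fromBlocks X 0 0 Y ∈ ambientOn c (m ⊕ n) ↔ X ∈ ambientOn c m ∧ Y ∈ ambientOn c n := by
  cases c
  · exact ⟨fun _ => ⟨trivial, trivial⟩, fun _ => trivial⟩
  · change Matrix.IsSymm _ ↔ Matrix.IsSymm _ ∧ Matrix.IsSymm _
    simp [Matrix.isSymm_fromBlocks_iff]
  · change Matrix.IsDiag _ ↔ Matrix.IsDiag _ ∧ Matrix.IsDiag _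
    simp [Matrix.isDiag_fromBlocks_iff]

theorem Matrix.isUnit_of_rank_eq {m : ℕ} {D : Matrix (Fin m) (Fin m) ℂ} (h : D.rank = m) :
    IsUnit D := by
  rw [← Matrix.mulVec_surjective_iff_isUnit]
  have : LinearMap.range D.mulVecLin = ⊤ :=
    Submodule.eq_top_of_finrank_eq (by rw [Module.finrank_fin_fun]; exact h)
  exact LinearMap.range_eq_top.1 this

/-- Conjugation by a pair of mutually inverse matrices. -/
def conjEquiv {a b : Type*} [Fintype a] [Fintype b] [DecidableEq a] [DecidableEq b]
    (Q : Matrix a b ℂ) (Q' : Matrix b a ℂ) (h : Q * Q' = 1) (h' : Q' * Q = 1) :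
    Matrix b b ℂ ≃ₗ[ℂ] Matrix a a ℂ where
  toFun Z := Q * Z * Q'
  map_add' Z W := by rw [Matrix.mul_add, Matrix.add_mul]
  map_smul' r Z := by simp
  invFun A := Q' * A * Q
  left_inv Z := by
    change Q' * (Q * Z * Q') * Q = Z
    rw [Matrix.mul_assoc Q, ← Matrix.mul_assoc Q' Q, h', Matrix.one_mul, Matrix.mul_assoc, h',
      Matrix.mul_one]
  right_inv A := by
    change Q * (Q' * A * Q) * Q' = A
    rw [Matrix.mul_assoc Q', ← Matrix.mul_assoc Q Q', h, Matrix.one_mul, Matrix.mul_assoc, h,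
      Matrix.mul_one]

theorem conjEquiv_one {a b : Type*} [Fintype a] [Fintype b] [DecidableEq a] [DecidableEq b]
    (Q : Matrix a b ℂ) (Q' : Matrix b a ℂ) (h : Q * Q' = 1) (h' : Q' * Q = 1) :
    conjEquiv Q Q' h h' 1 = 1 := by
  change Q * (1 : Matrix b b ℂ) * Q' = 1
  rw [Matrix.mul_one, h]

theorem rank_conjEquiv {a b : Type*} [Fintype a] [Fintype b] [DecidableEq a] [DecidableEq b]
    (Q : Matrix a b ℂ) (Q' : Matrix b a ℂ) (h : Q * Q' = 1) (h' : Q' * Q = 1)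
    (Z : Matrix b b ℂ) : (conjEquiv Q Q' h h' Z).rank = Z.rank := by
  refine le_antisymm ((Matrix.rank_mul_le_left _ _).trans (Matrix.rank_mul_le_right _ _)) ?_
  have : Q' * conjEquiv Q Q' h h' Z * Q = Z := (conjEquiv Q Q' h h').symm_apply_apply Z
  conv_lhs => rw [← this]
  exact (Matrix.rank_mul_le_left _ _).trans (Matrix.rank_mul_le_right _ _)

/-- A linear identification of `n × n` matrices with block matrices that respects ranks, the
identity and the ambient space, and turns `A` into a block diagonal matrix with upper block `l`
and lower block not having the eigenvalue `l`. -/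
structure BlockForm (c : MatrixCase) (n k : ℕ) (A : Matrix (Fin n) (Fin n) ℂ) (l : ℂ) where
  /-- the identification -/
  equiv : Matrix (Fin k ⊕ Fin (n - k)) (Fin k ⊕ Fin (n - k)) ℂ ≃ₗ[ℂ] Matrix (Fin n) (Fin n) ℂ
  /-- the lower block -/
  block : Matrix (Fin (n - k)) (Fin (n - k)) ℂ
  map_one : equiv 1 = 1
  rank_map : ∀ Z, (equiv Z).rank = Z.rank
  map_mem : ∀ Z, equiv Z ∈ ambient c n ↔ Z ∈ ambientOn c (Fin k ⊕ Fin (n - k))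
  map_block : equiv (Matrix.fromBlocks (l • 1) 0 0 block) = A
  isUnit_block : IsUnit (block - l • 1)

theorem IsStrictEigenvalue.le {n k : ℕ} {A : Matrix (Fin n) (Fin n) ℂ} {l : ℂ}
    (h : IsStrictEigenvalue A l k) : k ≤ n := by
  have := geomMult_add_rank A l
  rw [h.2] at this
  omega

theorem IsStrictEigenvalue.rank_eq {n k : ℕ} {A : Matrix (Fin n) (Fin n) ℂ} {l : ℂ}
    (h : IsStrictEigenvalue A l k) : (A - l • (1 : Matrix (Fin n) (Fin n) ℂ)).rank = n - k := by
  have := geomMult_add_rank A l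
  rw [h.2] at this
  omega

/-- A block form arises as soon as `A - l` is mapped to a matrix with only a lower block. -/
def BlockForm.ofEquiv {c : MatrixCase} {n k : ℕ} {A : Matrix (Fin n) (Fin n) ℂ} {l : ℂ}
    (h : IsStrictEigenvalue A l k)
    (e : Matrix (Fin k ⊕ Fin (n - k)) (Fin k ⊕ Fin (n - k)) ℂ ≃ₗ[ℂ] Matrix (Fin n) (Fin n) ℂ)
    (D : Matrix (Fin (n - k)) (Fin (n - k)) ℂ) (h1 : e 1 = 1)
    (hr : ∀ Z, (e Z).rank = Z.rank)
    (hm : ∀ Z, e Z ∈ ambient c n ↔ Z ∈ ambientOn c (Fin k ⊕ Fin (n - k)))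
    (hD : e (Matrix.fromBlocks 0 0 0 D) = A - l • (1 : Matrix (Fin n) (Fin n) ℂ)) :
    BlockForm c n k A l where
  equiv := e
  block := D + l • 1
  map_one := h1
  rank_map := hr
  map_mem := hm
  map_block := by
    have : Matrix.fromBlocks (l • (1 : Matrix (Fin k) (Fin k) ℂ)) 0 0 (D + l • 1) =
        Matrix.fromBlocks 0 0 0 D +
          l • (1 : Matrix (Fin k ⊕ Fin (n - k)) (Fin k ⊕ Fin (n - k)) ℂ) := by
      rw [← Matrix.fromBlocks_one, Matrix.fromBlocks_smul, Matrix.fromBlocks_add]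
      simp
    rw [this, map_add, map_smul, hD, h1, sub_add_cancel]
  isUnit_block := by
    rw [add_sub_cancel_right]
    refine Matrix.isUnit_of_rank_eq ?_
    have := hr (Matrix.fromBlocks 0 0 0 D)
    rw [hD, h.rank_eq, Matrix.rank_fromBlocks_diagonal, Matrix.rank_zero, zero_add] at this
    exact this.symm

/-! #### Diagonal matrices -/

theorem nonempty_blockForm_diag {n k : ℕ} {A : Matrix (Fin n) (Fin n) ℂ} {l : ℂ}
    (hA : A.IsDiag) (h : IsStrictEigenvalue A l k) : Nonempty (BlockForm .diag n k A l) := by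
  classical
  obtain ⟨d, rfl⟩ : ∃ d, A = Matrix.diagonal d := ⟨A.diag, hA.diagonal_diag.symm⟩
  have hsub : Matrix.diagonal d - l • (1 : Matrix (Fin n) (Fin n) ℂ) =
      Matrix.diagonal fun i => d i - l := by
    rw [Matrix.smul_one_eq_diagonal, Matrix.diagonal_sub]
  have hr := h.rank_eq
  rw [hsub, Matrix.rank_diagonal] at hr
  have hk := h.le
  have hr' : Fintype.card {i // ¬ (d i - l ≠ 0)} = k := by
    rw [Fintype.card_subtype_compl, hr, Fintype.card_fin]
    omega
  -- The `k` indices with `d i = l` must come first, whereas `Equiv.sumCompl` lists those with `d i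
  -- - l ≠ 0` first; hence the swap.
  let e : Fin k ⊕ Fin (n - k) ≃ Fin n :=
    (Equiv.sumCongr (Fintype.equivFinOfCardEq hr').symm
      (Fintype.equivFinOfCardEq hr).symm).trans
      ((Equiv.sumComm _ _).trans (Equiv.sumCompl _))
  have hinl : ∀ i, d (e (Sum.inl i)) - l = 0 := fun i =>
    not_not.1 ((Fintype.equivFinOfCardEq hr').symm i).2
  refine ⟨BlockForm.ofEquiv h (Matrix.reindexLinearEquiv ℂ ℂ e e)
    (Matrix.diagonal fun i => d (e (Sum.inr i)) - l) ?_ ?_ ?_ ?_⟩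
  · simp
  · intro Z
    exact Matrix.rank_reindex e e Z
  · intro Z
    constructor
    · intro hZ i j hij
      have := hZ (i := e i) (j := e j) (e.injective.ne hij)
      simpa using this
    · intro hZ
      exact Matrix.IsDiag.submatrix (A := Z) hZ e.symm.injective
  · rw [hsub, Matrix.coe_reindexLinearEquiv, ← Matrix.diagonal_zero,
      ← Equiv.eq_symm_apply]
    ext (i | i) (j | j)
    · simp [Matrix.diagonal_apply, hinl]
    · simp
    · simp
    · simp [Matrix.diagonal_apply]

/-! #### Splitting by kernel and range -/

/-- The endomorphism defined by `A - l`. -/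
noncomputable def shiftEnd {n : ℕ} (A : Matrix (Fin n) (Fin n) ℂ) (l : ℂ) : End ℂ (Fin n → ℂ) :=
  Matrix.toLin' (A - l • (1 : Matrix (Fin n) (Fin n) ℂ))

theorem ker_shiftEnd {n : ℕ} (A : Matrix (Fin n) (Fin n) ℂ) (l : ℂ) :
    LinearMap.ker (shiftEnd A l) = End.eigenspace (Matrix.toLin' A) l := by
  have h : shiftEnd A l = Matrix.toLin' A - l • (1 : End ℂ (Fin n → ℂ)) := by
    simp [shiftEnd, Module.End.one_eq_id]
  rw [End.eigenspace_def, h]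

/-- Equality of the two multiplicities means that the eigenspace is the whole generalized
eigenspace. So `(A - l)² x = 0` implies `(A - l) x = 0`, the kernel meets the range trivially, and
rank-nullity does the rest. -/
theorem IsStrictEigenvalue.isCompl {n k : ℕ} {A : Matrix (Fin n) (Fin n) ℂ} {l : ℂ}
    (h : IsStrictEigenvalue A l k) :
    IsCompl (LinearMap.ker (shiftEnd A l)) (LinearMap.range (shiftEnd A l)) := by
  have hle : End.eigenspace (Matrix.toLin' A) l ≤ End.maxGenEigenspace (Matrix.toLin' A) l :=
    End.genEigenspace_le_maximal _ _ _
  have heq : End.eigenspace (Matrix.toLin' A) l = End.maxGenEigenspace (Matrix.toLin' A) l := by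
    refine Submodule.eq_of_le_of_finrank_eq hle ?_
    rw [LinearMap.finrank_maxGenEigenspace_eq, Matrix.charpoly_toLin', h.1]
    exact h.2
  have h2 : ∀ x, shiftEnd A l (shiftEnd A l x) = 0 → shiftEnd A l x = 0 := by
    intro x hx
    have hsh : shiftEnd A l = Matrix.toLin' A - l • (1 : End ℂ (Fin n → ℂ)) := by
      simp [shiftEnd, Module.End.one_eq_id]
    have : x ∈ End.maxGenEigenspace (Matrix.toLin' A) l := by
      rw [End.mem_maxGenEigenspace]
      exact ⟨2, by rw [← hsh, sq]; exact hx⟩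
    rw [← heq, ← ker_shiftEnd] at this
    exact this
  refine (Submodule.isCompl_iff_disjoint _ _ ?_).2 ?_
  · rw [add_comm, LinearMap.finrank_range_add_finrank_ker]
  · rw [Submodule.disjoint_def]
    rintro _ hx ⟨y, rfl⟩
    exact h2 y hx

theorem IsStrictEigenvalue.finrank_ker {n k : ℕ} {A : Matrix (Fin n) (Fin n) ℂ} {l : ℂ}
    (h : IsStrictEigenvalue A l k) : finrank ℂ (LinearMap.ker (shiftEnd A l)) = k := by
  rw [ker_shiftEnd]
  exact h.2

theorem IsStrictEigenvalue.finrank_range {n k : ℕ} {A : Matrix (Fin n) (Fin n) ℂ} {l : ℂ}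
    (h : IsStrictEigenvalue A l k) : finrank ℂ (LinearMap.range (shiftEnd A l)) = n - k := by
  rw [← h.rank_eq, Matrix.rank, shiftEnd, Matrix.toLin'_apply']

/-- The basis adapted to the splitting into kernel and range. -/
noncomputable def splitBasis {n k m : ℕ} {A : Matrix (Fin n) (Fin n) ℂ} {l : ℂ}
    (hc : IsCompl (LinearMap.ker (shiftEnd A l)) (LinearMap.range (shiftEnd A l)))
    (bK : Basis (Fin k) ℂ (LinearMap.ker (shiftEnd A l)))
    (bR : Basis (Fin m) ℂ (LinearMap.range (shiftEnd A l))) :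
    Basis (Fin k ⊕ Fin m) ℂ (Fin n → ℂ) :=
  (bK.prod bR).map (Submodule.prodEquivOfIsCompl _ _ hc)

section splitBasis

variable {n k m : ℕ} {A : Matrix (Fin n) (Fin n) ℂ} {l : ℂ}
  (hc : IsCompl (LinearMap.ker (shiftEnd A l)) (LinearMap.range (shiftEnd A l)))
  (bK : Basis (Fin k) ℂ (LinearMap.ker (shiftEnd A l)))
  (bR : Basis (Fin m) ℂ (LinearMap.range (shiftEnd A l)))

theorem splitBasis_inl (i : Fin k) : splitBasis hc bK bR (Sum.inl i) = bK i := by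
  simp [splitBasis]

theorem splitBasis_inr (i : Fin m) : splitBasis hc bK bR (Sum.inr i) = bR i := by
  simp [splitBasis]

theorem splitBasis_repr_inl (x : Fin n → ℂ) (i : Fin k) :
    (splitBasis hc bK bR).repr (shiftEnd A l x) (Sum.inl i) = 0 := by
  have : (Submodule.prodEquivOfIsCompl _ _ hc).symm (shiftEnd A l x) =
      (0, ⟨shiftEnd A l x, x, rfl⟩) := by
    rw [LinearEquiv.symm_apply_eq]
    simp
  simp [splitBasis, this]

/-- In the adapted basis the upper rows of `A - l` vanish because its values lie in the range, and
the left columns because the kernel is killed. `Q'` is any inverse of `Q`, so that the transpose can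
be inserted in the symmetric case. -/
theorem conjEquiv_splitBasis
    (Q : Matrix (Fin n) (Fin k ⊕ Fin m) ℂ) (Q' : Matrix (Fin k ⊕ Fin m) (Fin n) ℂ)
    (hQ : Q = (Pi.basisFun ℂ (Fin n)).toMatrix (splitBasis hc bK bR))
    (h : Q * Q' = 1) (h' : Q' * Q = 1) :
    ∃ D, conjEquiv Q Q' h h' (Matrix.fromBlocks 0 0 0 D) =
      A - l • (1 : Matrix (Fin n) (Fin n) ℂ) := by
  set b := splitBasis hc bK bR with hb
  have hQ' : Q' = b.toMatrix (Pi.basisFun ℂ (Fin n)) := by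
    have h3 : Q * b.toMatrix (Pi.basisFun ℂ (Fin n)) = 1 := by
      rw [hQ]; exact Basis.toMatrix_mul_toMatrix_flip _ _
    calc Q' = Q' * (Q * b.toMatrix (Pi.basisFun ℂ (Fin n))) := by rw [h3, Matrix.mul_one]
      _ = _ := by rw [← Matrix.mul_assoc, h', Matrix.one_mul]
  let Z := LinearMap.toMatrix b b (shiftEnd A l)
  have hZ : conjEquiv Q Q' h h' Z = A - l • (1 : Matrix (Fin n) (Fin n) ℂ) := by
    change Q * Z * Q' = _
    rw [hQ', hQ, basis_toMatrix_mul_linearMap_toMatrix_mul_basis_toMatrix,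
      LinearMap.toMatrix_eq_toMatrix', shiftEnd, LinearMap.toMatrix'_toLin']
  refine ⟨Z.toBlocks₂₂, ?_⟩
  rw [← hZ]
  congr 1
  conv_rhs => rw [← Matrix.fromBlocks_toBlocks Z]
  have hrow : ∀ i j, Z (Sum.inl i) j = 0 := fun i j => by
    change LinearMap.toMatrix b b (shiftEnd A l) _ _ = 0
    rw [LinearMap.toMatrix_apply]
    exact splitBasis_repr_inl hc bK bR _ _
  have hcol : ∀ i j, Z i (Sum.inl j) = 0 := fun i j => by
    have h0 : shiftEnd A l (b (Sum.inl j)) = 0 := by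
      rw [hb, splitBasis_inl]
      exact (bK j).2
    change LinearMap.toMatrix b b (shiftEnd A l) _ _ = 0
    rw [LinearMap.toMatrix_apply, h0, map_zero]
    rfl
  congr 1
  · ext i j; exact (hrow _ _).symm
  · ext i j; exact (hrow _ _).symm
  · ext i j; exact (hcol _ _).symm

end splitBasis

theorem nonempty_blockForm_general {n k : ℕ} {A : Matrix (Fin n) (Fin n) ℂ} {l : ℂ}
    (h : IsStrictEigenvalue A l k) : Nonempty (BlockForm .general n k A l) := by
  let bK := Module.finBasisOfFinrankEq ℂ _ h.finrank_ker
  let bR := Module.finBasisOfFinrankEq ℂ _ h.finrank_range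
  let b := splitBasis h.isCompl bK bR
  have h1 : (Pi.basisFun ℂ (Fin n)).toMatrix b * b.toMatrix (Pi.basisFun ℂ (Fin n)) = 1 :=
    Basis.toMatrix_mul_toMatrix_flip _ _
  have h2 : b.toMatrix (Pi.basisFun ℂ (Fin n)) * (Pi.basisFun ℂ (Fin n)).toMatrix b = 1 :=
    Basis.toMatrix_mul_toMatrix_flip _ _
  obtain ⟨D, hD⟩ := conjEquiv_splitBasis h.isCompl bK bR _ _ rfl h1 h2
  refine ⟨BlockForm.ofEquiv h (conjEquiv _ _ h1 h2) D ?_ (rank_conjEquiv _ _ h1 h2) ?_ hD⟩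
  · exact conjEquiv_one _ _ h1 h2
  · exact fun Z => ⟨fun _ => trivial, fun _ => Submodule.mem_top⟩

/-! #### Symmetric matrices -/

/-- A symmetric form has an orthogonal basis; nondegeneracy makes its diagonal values nonzero, and
their complex square roots normalize the basis. -/
theorem exists_orthonormal_basis_of_bilinForm {V : Type*} [AddCommGroup V] [Module ℂ V]
    [FiniteDimensional ℂ V] {d : ℕ} (hd : finrank ℂ V = d) {B : LinearMap.BilinForm ℂ V}
    (hs : ∀ x y, B x y = B y x) (hB : ∀ x, (∀ y, B x y = 0) → x = 0) :
    ∃ b : Basis (Fin d) ℂ V, ∀ i j, B (b i) (b j) = if i = j then 1 else 0 := by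
  subst hd
  have : Invertible (2 : ℂ) := invertibleOfNonzero two_ne_zero
  obtain ⟨v, hv⟩ := LinearMap.BilinForm.exists_orthogonal_basis (B := B) ⟨hs⟩
  have hne : ∀ i, B (v i) (v i) ≠ 0 := by
    intro i hi
    refine v.ne_zero i (hB _ fun y => ?_)
    have : B (v i) = 0 := v.ext fun j => by
      by_cases hij : i = j
      · subst hij; exact hi
      · exact hv hij
    rw [this]; rfl
  choose s hs' using fun i => IsSquare.exists_mul_self (B (v i) (v i)) (IsAlgClosed.exists_eq_mul_self _)
  have hs0 : ∀ i, s i ≠ 0 := fun i h0 => hne i (by rw [hs' i, h0, zero_mul])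
  refine ⟨v.unitsSMul fun i => (Units.mk0 (s i) (hs0 i))⁻¹, fun i j => ?_⟩
  rw [Basis.unitsSMul_apply, Basis.unitsSMul_apply]
  simp only [Units.smul_def, map_smul, LinearMap.smul_apply, Units.val_inv_eq_inv_val,
    Units.val_mk0, smul_eq_mul]
  split_ifs with hij
  · subst hij
    rw [hs' i]
    field_simp [hs0 i]
  · have : B (v i) (v j) = 0 := hv hij
    rw [this]; simp

/-- The complex dot product has isotropic vectors, so nondegeneracy on a subspace is not automatic.
Here a vector of `p` orthogonal to `p` is also orthogonal to `q`, hence to everything. -/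
theorem exists_orthonormal_basis_submodule {n d : ℕ} (p q : Submodule ℂ (Fin n → ℂ))
    (hpq : p ⊔ q = ⊤) (horth : ∀ x ∈ p, ∀ y ∈ q, x ⬝ᵥ y = 0) (hd : finrank ℂ p = d) :
    ∃ b : Basis (Fin d) ℂ p, ∀ i j, (b i : Fin n → ℂ) ⬝ᵥ b j = if i = j then 1 else 0 := by
  let B : LinearMap.BilinForm ℂ p := LinearMap.mk₂ ℂ (fun x y => (x : Fin n → ℂ) ⬝ᵥ y)
    (fun x y z => add_dotProduct _ _ _) (fun a x y => smul_dotProduct _ _ _)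
    (fun x y z => dotProduct_add _ _ _) (fun a x y => dotProduct_smul _ _ _)
  refine exists_orthonormal_basis_of_bilinForm (B := B) hd (fun x y => dotProduct_comm (x : Fin n → ℂ) y) ?_
  intro x hx
  refine Subtype.ext (dotProduct_eq_zero _ fun w => ?_)
  obtain ⟨y, hy, z, hz, rfl⟩ := Submodule.mem_sup.1 (hpq ▸ Submodule.mem_top : w ∈ p ⊔ q)
  rw [dotProduct_add, horth _ x.2 _ hz, add_zero]
  exact hx ⟨y, hy⟩

/-- Symmetry makes kernel and range of `A - l` orthogonal. Orthonormal bases of both yield a complex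
orthogonal `Q`, and conjugation by it commutes with transposition. -/
theorem nonempty_blockForm_sym {n k : ℕ} {A : Matrix (Fin n) (Fin n) ℂ} {l : ℂ}
    (hA : A.IsSymm) (h : IsStrictEigenvalue A l k) : Nonempty (BlockForm .sym n k A l) := by
  have hS : (A - l • (1 : Matrix (Fin n) (Fin n) ℂ)).IsSymm :=
    hA.sub (Matrix.isSymm_one.smul l)
  have horth : ∀ x ∈ LinearMap.ker (shiftEnd A l), ∀ y ∈ LinearMap.range (shiftEnd A l),
      x ⬝ᵥ y = 0 := by
    rintro x hx _ ⟨y, rfl⟩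
    have hx' : (A - l • (1 : Matrix (Fin n) (Fin n) ℂ)).mulVec x = 0 := hx
    rw [shiftEnd, Matrix.toLin'_apply, Matrix.dotProduct_mulVec, ← Matrix.mulVec_transpose, hS.eq,
      hx', zero_dotProduct]
  obtain ⟨bK, hbK⟩ := exists_orthonormal_basis_submodule _ _ h.isCompl.sup_eq_top horth
    h.finrank_ker
  obtain ⟨bR, hbR⟩ := exists_orthonormal_basis_submodule _ _ h.isCompl.symm.sup_eq_top
    (fun x hx y hy => by rw [dotProduct_comm]; exact horth y hy x hx) h.finrank_range
  let b := splitBasis h.isCompl bK bR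
  have hb : ∀ i j, b i ⬝ᵥ b j = if i = j then 1 else 0 := by
    rintro (i | i) (j | j)
    · simp only [b, splitBasis_inl, hbK, Sum.inl.injEq]
    · simp only [b, splitBasis_inl, splitBasis_inr, reduceCtorEq, if_false]
      exact horth _ (bK i).2 _ (bR j).2
    · simp only [b, splitBasis_inl, splitBasis_inr, reduceCtorEq, if_false]
      rw [dotProduct_comm]
      exact horth _ (bK j).2 _ (bR i).2
    · simp only [b, splitBasis_inr, hbR, Sum.inr.injEq]
  let Q := (Pi.basisFun ℂ (Fin n)).toMatrix b
  have h2 : Q.transpose * Q = 1 := by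
    ext i j
    rw [Matrix.one_apply, ← hb i j, Matrix.mul_apply]
    rfl
  have h1 : Q * Q.transpose = 1 := by
    have hk := h.le
    refine (Matrix.mul_eq_one_comm_of_card_eq _ _ _ ?_).1 h2
    simp only [Fintype.card_sum, Fintype.card_fin]
    omega
  obtain ⟨D, hD⟩ := conjEquiv_splitBasis h.isCompl bK bR Q Q.transpose rfl h1 h2
  refine ⟨BlockForm.ofEquiv h (conjEquiv _ _ h1 h2) D ?_ (rank_conjEquiv _ _ h1 h2) ?_ hD⟩
  · exact conjEquiv_one _ _ h1 h2
  · intro Z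
    have hT : (conjEquiv Q Q.transpose h1 h2 Z).transpose =
        conjEquiv Q Q.transpose h1 h2 Z.transpose := by
      change (Q * Z * Q.transpose).transpose = Q * Z.transpose * Q.transpose
      rw [Matrix.transpose_mul, Matrix.transpose_mul, Matrix.transpose_transpose,
        Matrix.mul_assoc]
    change (conjEquiv Q Q.transpose h1 h2 Z).transpose = _ ↔ Z.transpose = Z
    rw [hT, EmbeddingLike.apply_eq_iff_eq]

theorem nonempty_blockForm {c : MatrixCase} {n k : ℕ} {A : Matrix (Fin n) (Fin n) ℂ} {l : ℂ}
    (hA : A ∈ ambient c n) (h : IsStrictEigenvalue A l k) : Nonempty (BlockForm c n k A l) := by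
  cases c
  · exact nonempty_blockForm_general h
  · exact nonempty_blockForm_sym hA h
  · exact nonempty_blockForm_diag hA h

/-! ### Conjugation by matrix exponentials -/

theorem mul_neg_add_add_mul {R : Type*} [Ring R] (a z w : R) :
    z * -a + (w + a * z) = a * z - z * a + w := by
  rw [mul_neg]
  abel

/-- Conjugation of `Z` by the exponential of `N`. -/
noncomputable def expConj {ι : Type*} [Fintype ι] [DecidableEq ι] (N Z : Matrix ι ι ℂ) :
    Matrix ι ι ℂ :=
  NormedSpace.exp N * Z * NormedSpace.exp (-N)

section expConj

variable {ι : Type*} [Fintype ι] [DecidableEq ι]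

theorem exp_mul_exp_neg_matrix (N : Matrix ι ι ℂ) :
    NormedSpace.exp N * NormedSpace.exp (-N) = 1 := by
  rw [Matrix.exp_neg]
  exact Matrix.mul_nonsing_inv _ ((Matrix.isUnit_iff_isUnit_det _).1 (Matrix.isUnit_exp N))

/-- Matrices as operators. -/
noncomputable def matrixOperator (ι : Type*) [Fintype ι] [DecidableEq ι] :
    Matrix ι ι ℂ ≃ₐ[ℂ] ((ι → ℂ) →L[ℂ] (ι → ℂ)) :=
  Matrix.toLinAlgEquiv'.trans (Module.End.toContinuousLinearMap (ι → ℂ))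

/-- Matrices as operators, as a continuous linear equivalence. -/
noncomputable def matrixOperatorL (ι : Type*) [Fintype ι] [DecidableEq ι] :
    Matrix ι ι ℂ ≃L[ℂ] ((ι → ℂ) →L[ℂ] (ι → ℂ)) :=
  (matrixOperator ι).toLinearEquiv.toContinuousLinearEquiv

theorem matrixOperatorL_apply (Z : Matrix ι ι ℂ) : matrixOperatorL ι Z = matrixOperator ι Z := rfl

/-- The entrywise sup norm is not submultiplicative in general. Operators form a Banach algebra,
where analyticity and the derivative of the exponential can be used. -/
theorem expConj_eq (N Z : Matrix ι ι ℂ) :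
    expConj N Z = (matrixOperatorL ι).symm
      (NormedSpace.exp (matrixOperatorL ι N) * matrixOperatorL ι Z *
        NormedSpace.exp (-matrixOperatorL ι N)) := by
  have h : ∀ M, matrixOperator ι (NormedSpace.exp M) = NormedSpace.exp (matrixOperator ι M) := by
    intro M
    rw [NormedSpace.exp_eq_tsum ℂ, NormedSpace.exp_eq_tsum ℂ, ← matrixOperatorL_apply,
      ContinuousLinearEquiv.map_tsum]
    simp only [map_smul, matrixOperatorL_apply, map_pow]
  rw [ContinuousLinearEquiv.eq_symm_apply]
  simp only [matrixOperatorL_apply, expConj, map_mul, h, map_neg]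

theorem analyticAt_expConj (p : Matrix ι ι ℂ × Matrix ι ι ℂ) :
    AnalyticAt ℂ (fun p : Matrix ι ι ℂ × Matrix ι ι ℂ => expConj p.1 p.2) p := by
  simp only [expConj_eq]
  have hexp : ∀ T : (ι → ℂ) →L[ℂ] (ι → ℂ), AnalyticAt ℂ NormedSpace.exp T :=
    fun T => NormedSpace.exp_analytic T
  have h1 : AnalyticAt ℂ (fun p : Matrix ι ι ℂ × Matrix ι ι ℂ => matrixOperatorL ι p.1) p :=
    ((matrixOperatorL ι).toContinuousLinearMap.comp
      (ContinuousLinearMap.fst ℂ _ _)).analyticAt p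
  have h2 : AnalyticAt ℂ (fun p : Matrix ι ι ℂ × Matrix ι ι ℂ => matrixOperatorL ι p.2) p :=
    ((matrixOperatorL ι).toContinuousLinearMap.comp
      (ContinuousLinearMap.snd ℂ _ _)).analyticAt p
  exact ((matrixOperatorL ι).symm.toContinuousLinearMap.analyticAt _).comp
    ((((hexp _).comp h1).mul h2).mul ((hexp _).comp h1.neg))

/-- The derivative of `expConj` along a pair of linear maps. -/
theorem hasStrictFDerivAt_expConj {E : Type*} [NormedAddCommGroup E] [NormedSpace ℂ E]
    (N ζ : E →L[ℂ] Matrix ι ι ℂ) (Z : Matrix ι ι ℂ) (f' : E →L[ℂ] Matrix ι ι ℂ)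
    (hf' : ∀ x, f' x = N x * Z - Z * N x + ζ x) :
    HasStrictFDerivAt (fun x => expConj (N x) (Z + ζ x)) f' 0 := by
  simp only [expConj_eq]
  let L := (matrixOperatorL ι).toContinuousLinearMap
  have hN : HasStrictFDerivAt (fun x => matrixOperatorL ι (N x)) (L.comp N) 0 :=
    (L.comp N).hasStrictFDerivAt
  have hζ : HasStrictFDerivAt (fun x => matrixOperatorL ι (Z + ζ x)) (L.comp ζ) 0 :=
    (L.hasStrictFDerivAt (x := Z + ζ 0)).comp 0 (ζ.hasStrictFDerivAt.const_add Z)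
  have hexp : HasStrictFDerivAt (NormedSpace.exp)
      (1 : ((ι → ℂ) →L[ℂ] (ι → ℂ)) →L[ℂ] ((ι → ℂ) →L[ℂ] (ι → ℂ))) 0 :=
    hasStrictFDerivAt_exp_zero
  have h1 : HasStrictFDerivAt (fun x => NormedSpace.exp (matrixOperatorL ι (N x))) (L.comp N) 0 := by
    refine HasStrictFDerivAt.comp (g := NormedSpace.exp)
      (g' := (1 : ((ι → ℂ) →L[ℂ] (ι → ℂ)) →L[ℂ] ((ι → ℂ) →L[ℂ] (ι → ℂ)))) 0 ?_ hN
    simpa using hexp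
  have h2 : HasStrictFDerivAt (fun x => NormedSpace.exp (-matrixOperatorL ι (N x)))
      (-(L.comp N)) 0 := by
    refine HasStrictFDerivAt.comp (g := NormedSpace.exp)
      (g' := (1 : ((ι → ℂ) →L[ℂ] (ι → ℂ)) →L[ℂ] ((ι → ℂ) →L[ℂ] (ι → ℂ)))) 0 ?_ hN.neg
    simpa using hexp
  have h3 := ((matrixOperatorL ι).symm.toContinuousLinearMap.hasStrictFDerivAt).comp 0
    ((h1.mul' hζ).mul' h2)
  refine h3.congr_fderiv ?_
  ext1 x
  refine Eq.trans ?_ (hf' x).symm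
  let e := matrixOperatorL ι
  change e.symm (NormedSpace.exp (e (N 0)) * e (Z + ζ 0) * (-(e (N x))) +
    (NormedSpace.exp (e (N 0)) * e (ζ x) + e (N x) * e (Z + ζ 0)) *
      NormedSpace.exp (-(e (N 0)))) = _
  rw [ContinuousLinearEquiv.symm_apply_eq, map_zero, map_zero, map_zero, neg_zero,
    NormedSpace.exp_zero, one_mul, one_mul, mul_one, add_zero]
  simp only [e, matrixOperatorL_apply, map_add, map_sub, map_mul]
  exact mul_neg_add_add_mul _ _ _

theorem rank_expConj (N Z : Matrix ι ι ℂ) : (expConj N Z).rank = Z.rank := by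
  have h : ∀ M : Matrix ι ι ℂ, IsUnit (NormedSpace.exp M).det := fun M =>
    (Matrix.isUnit_iff_isUnit_det _).1 (Matrix.isUnit_exp M)
  rw [expConj, Matrix.rank_mul_eq_left_of_isUnit_det _ _ (h _),
    Matrix.rank_mul_eq_right_of_isUnit_det _ _ (h _)]

theorem expConj_sub_smul_one (N Z : Matrix ι ι ℂ) (a : ℂ) :
    expConj N (Z - a • 1) = expConj N Z - a • 1 := by
  simp only [expConj, Matrix.mul_sub, Matrix.sub_mul, Matrix.mul_smul, Matrix.smul_mul,
    Matrix.mul_one, exp_mul_exp_neg_matrix]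

theorem expConj_zero_left (Z : Matrix ι ι ℂ) : expConj 0 Z = Z := by
  simp [expConj, NormedSpace.exp_zero]

/-- The exponential of a skew matrix is orthogonal. -/
theorem expConj_transpose (N Z : Matrix ι ι ℂ) (hN : N.transpose = -N) :
    (expConj N Z).transpose = expConj N Z.transpose := by
  simp only [expConj, Matrix.transpose_mul, ← Matrix.exp_transpose, Matrix.transpose_neg, hN,
    neg_neg, Matrix.mul_assoc]

end expConj

/-! ### Generators of the conjugations -/

/-- The block off-diagonal matrices whose exponentials act on the ambient space. -/
def offDiagGen (c : MatrixCase) (m n : Type*) : Submodule ℂ (Matrix (m ⊕ n) (m ⊕ n) ℂ) where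
  carrier := {N | N.toBlocks₁₁ = 0 ∧ N.toBlocks₂₂ = 0 ∧ match c with
    | .general => True
    | .sym => N.transpose = -N
    | .diag => N = 0}
  add_mem' {A B} hA hB := by
    refine ⟨?_, ?_, ?_⟩
    · change A.toBlocks₁₁ + B.toBlocks₁₁ = 0
      rw [hA.1, hB.1, add_zero]
    · change A.toBlocks₂₂ + B.toBlocks₂₂ = 0
      rw [hA.2.1, hB.2.1, add_zero]
    · replace hA := hA.2.2
      replace hB := hB.2.2
      cases c
      · trivial
      · change (A + B).transpose = -(A + B)
        rw [Matrix.transpose_add, hA, hB, neg_add]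
      · change A + B = 0
        rw [hA, hB, add_zero]
  zero_mem' := by
    refine ⟨rfl, rfl, ?_⟩
    cases c
    · trivial
    · change (0 : Matrix (m ⊕ n) (m ⊕ n) ℂ).transpose = -0
      simp
    · rfl
  smul_mem' a A hA := by
    refine ⟨?_, ?_, ?_⟩
    · change a • A.toBlocks₁₁ = 0
      rw [hA.1, smul_zero]
    · change a • A.toBlocks₂₂ = 0
      rw [hA.2.1, smul_zero]
    · replace hA := hA.2.2
      cases c
      · trivial
      · change (a • A).transpose = -(a • A)
        rw [Matrix.transpose_smul, hA, smul_neg]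
      · change a • A = 0
        rw [hA, smul_zero]

theorem commutator_mem_ambientOn {c : MatrixCase} {m n : Type*} [Fintype m] [Fintype n]
    {N Z : Matrix (m ⊕ n) (m ⊕ n) ℂ}
    (hN : N ∈ offDiagGen c m n) (hZ : Z ∈ ambientOn c (m ⊕ n)) :
    N * Z - Z * N ∈ ambientOn c (m ⊕ n) := by
  have hN' := hN.2.2
  cases c
  · trivial
  · change (N * Z - Z * N).transpose = _
    rw [Matrix.transpose_sub, Matrix.transpose_mul, Matrix.transpose_mul,
      show Z.transpose = Z from hZ, show N.transpose = -N from hN']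
    simp only [Matrix.mul_neg, Matrix.neg_mul]
    abel
  · rw [show N = 0 from hN', Matrix.zero_mul, Matrix.mul_zero, sub_zero]
    exact zero_mem _

theorem eq_fromBlocks_of_mem_offDiagGen {c : MatrixCase} {m n : Type*}
    {N : Matrix (m ⊕ n) (m ⊕ n) ℂ}
    (hN : N ∈ offDiagGen c m n) : N = Matrix.fromBlocks 0 N.toBlocks₁₂ N.toBlocks₂₁ 0 := by
  conv_lhs => rw [← Matrix.fromBlocks_toBlocks N, hN.1, hN.2.1]

section generators

variable {c : MatrixCase} {m n : Type*} [Fintype m] [Fintype n] [DecidableEq m] [DecidableEq n]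

theorem expConj_mem_ambientOn {N Z : Matrix (m ⊕ n) (m ⊕ n) ℂ}
    (hN : N ∈ offDiagGen c m n) (hZ : Z ∈ ambientOn c (m ⊕ n)) :
    expConj N Z ∈ ambientOn c (m ⊕ n) := by
  have hN' := hN.2.2
  cases c
  · trivial
  · change (expConj N Z).transpose = _
    rw [expConj_transpose _ _ hN', show Z.transpose = Z from hZ]
  · rw [show N = 0 from hN', expConj_zero_left]
    exact hZ

/-- Since the upper block is scalar, the commutator acts on `S` and `T` by mere multiplication with
`D - l`, up to sign. -/
theorem commutator_fromBlocks (S : Matrix m n ℂ) (T : Matrix n m ℂ) (D : Matrix n n ℂ) (l : ℂ) :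
    Matrix.fromBlocks 0 S T 0 * Matrix.fromBlocks (l • 1) 0 0 D -
      Matrix.fromBlocks (l • 1) 0 0 D * Matrix.fromBlocks 0 S T 0 =
    Matrix.fromBlocks 0 (S * (D - l • 1)) (-((D - l • 1) * T)) 0 := by
  rw [Matrix.fromBlocks_multiply, Matrix.fromBlocks_multiply, sub_eq_add_neg,
    Matrix.fromBlocks_neg, Matrix.fromBlocks_add]
  congr 1 <;> simp [Matrix.mul_sub, Matrix.sub_mul] <;> abel

/-- The generator with prescribed commutator with a block diagonal matrix. -/
theorem exists_generator {D : Matrix n n ℂ} {l : ℂ} (hD : IsUnit (D - l • 1))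
    (hDm : D ∈ ambientOn c n) {M : Matrix (m ⊕ n) (m ⊕ n) ℂ} (hM : M ∈ ambientOn c (m ⊕ n)) :
    ∃ N ∈ offDiagGen c m n,
      N * Matrix.fromBlocks (l • 1) 0 0 D - Matrix.fromBlocks (l • 1) 0 0 D * N =
        Matrix.fromBlocks 0 M.toBlocks₁₂ M.toBlocks₂₁ 0 := by
  have hdet := (Matrix.isUnit_iff_isUnit_det _).1 hD
  -- The blocks solve `S (D - l) = M₁₂` and `-(D - l) T = M₂₁`. For symmetric `M` and `D` this gives
  -- `T = -Sᵀ`, so the generator is skew.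
  refine ⟨Matrix.fromBlocks 0 (M.toBlocks₁₂ * (D - l • 1)⁻¹) (-((D - l • 1)⁻¹ * M.toBlocks₂₁)) 0,
    ⟨rfl, rfl, ?_⟩, ?_⟩
  · cases c
    · trivial
    · have hM' : M.transpose = M := hM
      have h21 : M.toBlocks₁₂.transpose = M.toBlocks₂₁ := by
        ext i j
        exact congrFun (congrFun hM' (Sum.inr i)) (Sum.inl j)
      have h12 : M.toBlocks₂₁.transpose = M.toBlocks₁₂ := by
        rw [← h21, Matrix.transpose_transpose]
      have hDt : (D - l • 1).transpose = D - l • 1 := by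
        rw [Matrix.transpose_sub, show D.transpose = D from hDm, Matrix.transpose_smul,
          Matrix.transpose_one]
      change Matrix.transpose _ = -_
      rw [Matrix.fromBlocks_transpose, Matrix.fromBlocks_neg, Matrix.transpose_neg,
        Matrix.transpose_mul, Matrix.transpose_mul, Matrix.transpose_nonsing_inv, hDt, h21, h12]
      simp
    · have hM' : M.IsDiag := hM
      have h12 : M.toBlocks₁₂ = 0 := by
        ext i j
        exact hM' Sum.inl_ne_inr
      have h21 : M.toBlocks₂₁ = 0 := by
        ext i j
        exact hM' Sum.inr_ne_inl
      change Matrix.fromBlocks _ _ _ _ = 0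
      rw [h12, h21]
      simp
  · rw [commutator_fromBlocks, Matrix.mul_assoc, Matrix.nonsing_inv_mul _ hdet, Matrix.mul_one,
      Matrix.mul_neg, neg_neg, ← Matrix.mul_assoc, Matrix.mul_nonsing_inv _ hdet, Matrix.one_mul]

/-- The commutator is block off-diagonal and the other summand block diagonal, so both vanish
separately; then `D - l` cancels. This is the injectivity of the derivative. -/
theorem generator_eq_zero {D : Matrix n n ℂ} {l : ℂ} (hD : IsUnit (D - l • 1))
    {N : Matrix (m ⊕ n) (m ⊕ n) ℂ} (hN : N ∈ offDiagGen c m n) {X : Matrix m m ℂ}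
    {Y : Matrix n n ℂ}
    (h : N * Matrix.fromBlocks (l • 1) 0 0 D - Matrix.fromBlocks (l • 1) 0 0 D * N +
      Matrix.fromBlocks X 0 0 Y = 0) : X = 0 ∧ Y = 0 ∧ N = 0 := by
  have hdet := (Matrix.isUnit_iff_isUnit_det _).1 hD
  rw [eq_fromBlocks_of_mem_offDiagGen hN, commutator_fromBlocks, Matrix.fromBlocks_add,
    ← Matrix.fromBlocks_zero, Matrix.fromBlocks_inj] at h
  obtain ⟨h1, h2, h3, h4⟩ := h
  refine ⟨by simpa using h1, by simpa using h4, ?_⟩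
  have hS : N.toBlocks₁₂ = 0 := by
    rw [add_zero] at h2
    rw [← Matrix.mul_one N.toBlocks₁₂, ← Matrix.mul_nonsing_inv _ hdet, ← Matrix.mul_assoc, h2,
      Matrix.zero_mul]
  have hT : N.toBlocks₂₁ = 0 := by
    rw [add_zero, neg_eq_zero] at h3
    rw [← Matrix.one_mul N.toBlocks₂₁, ← Matrix.nonsing_inv_mul _ hdet, Matrix.mul_assoc, h3,
      Matrix.mul_zero]
  rw [eq_fromBlocks_of_mem_offDiagGen hN, hS, hT, Matrix.fromBlocks_zero]

end generators

/-! ### The local parametrization of the ambient space -/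

namespace BlockForm

variable {c : MatrixCase} {n k : ℕ} {A : Matrix (Fin n) (Fin n) ℂ} {l : ℂ}

/-- The block diagonal matrix of a block form. -/
def diagonal (b : BlockForm c n k A l) : Matrix (Fin k ⊕ Fin (n - k)) (Fin k ⊕ Fin (n - k)) ℂ :=
  Matrix.fromBlocks (l • 1) 0 0 b.block

theorem diagonal_mem (b : BlockForm c n k A l) (hA : A ∈ ambient c n) :
    b.diagonal ∈ ambientOn c (Fin k ⊕ Fin (n - k)) := by
  rw [← b.map_mem, diagonal, b.map_block]
  exact hA

/-- The parameters besides the upper block: the lower block and the generator. -/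
abbrev Aux (c : MatrixCase) (n k : ℕ) : Type :=
  ambientOn c (Fin (n - k)) × offDiagGen c (Fin k) (Fin (n - k))

/-- The block diagonal matrix given by the parameters. -/
def blockDiag (c : MatrixCase) (n k : ℕ) : (ambient c k × Aux c n k) →ₗ[ℂ]
    Matrix (Fin k ⊕ Fin (n - k)) (Fin k ⊕ Fin (n - k)) ℂ where
  toFun x := Matrix.fromBlocks x.1.1 0 0 x.2.1.1
  map_add' x y := by
    rw [Matrix.fromBlocks_add]
    simp
  map_smul' a x := by
    rw [RingHom.id_apply, Matrix.fromBlocks_smul]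
    simp

/-- The generator given by the parameters. -/
def generator (c : MatrixCase) (n k : ℕ) : (ambient c k × Aux c n k) →ₗ[ℂ]
    Matrix (Fin k ⊕ Fin (n - k)) (Fin k ⊕ Fin (n - k)) ℂ :=
  (offDiagGen c (Fin k) (Fin (n - k))).subtype ∘ₗ LinearMap.snd ℂ _ _ ∘ₗ LinearMap.snd ℂ _ _

theorem generator_mem (x : ambient c k × Aux c n k) :
    generator c n k x ∈ offDiagGen c (Fin k) (Fin (n - k)) :=
  x.2.2.2

theorem blockDiag_mem (x : ambient c k × Aux c n k) :
    blockDiag c n k x ∈ ambientOn c (Fin k ⊕ Fin (n - k)) :=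
  fromBlocks_mem_ambientOn.2 ⟨by rw [ambientOn_fin]; exact x.1.2, x.2.1.2⟩

/-- The derivative of the parametrization before the identification with `n × n` matrices. -/
def preDeriv (b : BlockForm c n k A l) : (ambient c k × Aux c n k) →ₗ[ℂ]
    Matrix (Fin k ⊕ Fin (n - k)) (Fin k ⊕ Fin (n - k)) ℂ :=
  LinearMap.mulRight ℂ b.diagonal ∘ₗ generator c n k -
    LinearMap.mulLeft ℂ b.diagonal ∘ₗ generator c n k + blockDiag c n k

theorem preDeriv_apply (b : BlockForm c n k A l) (x : ambient c k × Aux c n k) :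
    b.preDeriv x = generator c n k x * b.diagonal - b.diagonal * generator c n k x +
      blockDiag c n k x := rfl

theorem preDeriv_mem (b : BlockForm c n k A l) (hA : A ∈ ambient c n)
    (x : ambient c k × Aux c n k) :
    b.preDeriv x ∈ ambientOn c (Fin k ⊕ Fin (n - k)) :=
  add_mem (commutator_mem_ambientOn (generator_mem x) (b.diagonal_mem hA)) (blockDiag_mem x)

theorem preDeriv_injective (b : BlockForm c n k A l) : Function.Injective b.preDeriv := by
  rw [← LinearMap.ker_eq_bot, LinearMap.ker_eq_bot']
  intro x hx
  obtain ⟨h1, h2, h3⟩ := generator_eq_zero b.isUnit_block (generator_mem x) hx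
  exact Prod.ext (Subtype.ext h1) (Prod.ext (Subtype.ext h2) (Subtype.ext h3))

theorem exists_preDeriv_eq (b : BlockForm c n k A l) (hA : A ∈ ambient c n)
    {M : Matrix (Fin k ⊕ Fin (n - k)) (Fin k ⊕ Fin (n - k)) ℂ}
    (hM : M ∈ ambientOn c (Fin k ⊕ Fin (n - k))) : ∃ x, b.preDeriv x = M := by
  obtain ⟨N, hN, h⟩ := exists_generator b.isUnit_block
    (fromBlocks_mem_ambientOn.1 (b.diagonal_mem hA)).2 hM
  -- The block diagonal part is `M` minus a commutator, and both lie in the ambient space.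
  have hd : Matrix.fromBlocks M.toBlocks₁₁ 0 0 M.toBlocks₂₂ ∈
      ambientOn c (Fin k ⊕ Fin (n - k)) := by
    have : Matrix.fromBlocks M.toBlocks₁₁ 0 0 M.toBlocks₂₂ =
        M - (N * b.diagonal - b.diagonal * N) := by
      rw [diagonal, h]
      conv_rhs => rw [← Matrix.fromBlocks_toBlocks M]
      rw [sub_eq_add_neg, Matrix.fromBlocks_neg, Matrix.fromBlocks_add]
      simp
    rw [this]
    exact sub_mem hM (commutator_mem_ambientOn hN (b.diagonal_mem hA))
  obtain ⟨h1, h2⟩ := fromBlocks_mem_ambientOn.1 hd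
  refine ⟨(⟨M.toBlocks₁₁, by rw [← ambientOn_fin]; exact h1⟩, ⟨M.toBlocks₂₂, h2⟩, ⟨N, hN⟩), ?_⟩
  rw [preDeriv_apply]
  change N * b.diagonal - b.diagonal * N + Matrix.fromBlocks M.toBlocks₁₁ 0 0 M.toBlocks₂₂ = M
  rw [diagonal, h, Matrix.fromBlocks_add]
  conv_rhs => rw [← Matrix.fromBlocks_toBlocks M]
  simp

/-- The derivative of the parametrization. -/
noncomputable def deriv (b : BlockForm c n k A l) (hA : A ∈ ambient c n) :
    (ambient c k × Aux c n k) ≃ₗ[ℂ] ambient c n :=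
  LinearEquiv.ofBijective
    ((b.equiv.toLinearMap ∘ₗ b.preDeriv).codRestrict (ambient c n) fun x =>
      (b.map_mem _).2 (b.preDeriv_mem hA x))
    ⟨fun _ _ h => b.preDeriv_injective (b.equiv.injective (congrArg Subtype.val h)), fun M => by
      obtain ⟨x, hx⟩ := b.exists_preDeriv_eq hA (M := b.equiv.symm M)
        ((b.map_mem _).1 (by rw [LinearEquiv.apply_symm_apply]; exact M.2))
      refine ⟨x, Subtype.ext ?_⟩
      change b.equiv (b.preDeriv x) = M
      rw [hx, LinearEquiv.apply_symm_apply]⟩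

/-- The bijective derivative forces the number of free parameters to be `δ`, with no count in the
separate cases. -/
theorem finrank_aux (b : BlockForm c n k A l) (hA : A ∈ ambient c n) :
    finrank ℂ (Aux c n k) = familyDim c n k := by
  have h := (b.deriv hA).finrank_eq
  rw [Module.finrank_prod] at h
  rw [familyDim, ← h, Nat.add_sub_cancel_left]

/-- The coordinates on the parameter space. -/
noncomputable def coords (b : BlockForm c n k A l) (hA : A ∈ ambient c n) :
    (ambient c k × (Fin (familyDim c n k) → ℂ)) ≃ₗ[ℂ] (ambient c k × Aux c n k) :=
  (LinearEquiv.refl ℂ _).prodCongr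
    (LinearEquiv.ofFinrankEq _ _ (by rw [Module.finrank_fin_fun, b.finrank_aux hA]))

theorem coords_fst (b : BlockForm c n k A l) (hA : A ∈ ambient c n)
    (x : ambient c k × (Fin (familyDim c n k) → ℂ)) : (b.coords hA x).1 = x.1 := rfl

/-- The parametrization of the matrices near `A`. -/
noncomputable def param (b : BlockForm c n k A l) (hA : A ∈ ambient c n)
    (x : ambient c k × (Fin (familyDim c n k) → ℂ)) : ambient c n :=
  ⟨b.equiv (expConj (generator c n k (b.coords hA x))
    (b.diagonal + blockDiag c n k (b.coords hA x))),
    (b.map_mem _).2 (expConj_mem_ambientOn (generator_mem _)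
      (add_mem (b.diagonal_mem hA) (blockDiag_mem _)))⟩

theorem param_zero (b : BlockForm c n k A l) (hA : A ∈ ambient c n) :
    b.param hA 0 = ⟨A, hA⟩ := by
  refine Subtype.ext ?_
  simp only [param, map_zero, add_zero, expConj_zero_left]
  exact b.map_block

/-- Composing with a projection turns the subspace-valued `param` into a continuous linear map
applied to a matrix-valued one, so its analyticity and derivative can be computed among all
matrices. -/
theorem exists_projection (c : MatrixCase) (n : ℕ) :
    ∃ π : Matrix (Fin n) (Fin n) ℂ →L[ℂ] ambient c n, ∀ B : ambient c n, π B = B := by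
  obtain ⟨π, hπ⟩ := (ambient c n).subtype.exists_leftInverse_of_injective
    (LinearMap.ker_eq_bot.2 (ambient c n).injective_subtype)
  exact ⟨LinearMap.toContinuousLinearMap π, fun B => LinearMap.congr_fun hπ B⟩

theorem analyticAt_param (b : BlockForm c n k A l) (hA : A ∈ ambient c n)
    (x : ambient c k × (Fin (familyDim c n k) → ℂ)) : AnalyticAt ℂ (b.param hA) x := by
  obtain ⟨π, hπ⟩ := exists_projection c n
  let Λ := π.comp (LinearMap.toContinuousLinearMap b.equiv.toLinearMap)
  let N := LinearMap.toContinuousLinearMap (generator c n k ∘ₗ (b.coords hA).toLinearMap)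
  let ζ := LinearMap.toContinuousLinearMap (blockDiag c n k ∘ₗ (b.coords hA).toLinearMap)
  have h : b.param hA = fun x => Λ (expConj (N x) (b.diagonal + ζ x)) :=
    funext fun x => (hπ (b.param hA x)).symm
  rw [h]
  refine (Λ.analyticAt _).comp ?_
  exact (analyticAt_expConj (N x, b.diagonal + ζ x)).comp
    (f := fun x => (N x, b.diagonal + ζ x))
    ((N.analyticAt x).prod (analyticAt_const.add (ζ.analyticAt x)))

theorem hasStrictFDerivAt_param (b : BlockForm c n k A l) (hA : A ∈ ambient c n) :
    HasStrictFDerivAt (b.param hA)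
      (((b.coords hA).trans (b.deriv hA)).toContinuousLinearEquiv :
        (ambient c k × (Fin (familyDim c n k) → ℂ)) →L[ℂ] ambient c n) 0 := by
  obtain ⟨π, hπ⟩ := exists_projection c n
  let Λ := π.comp (LinearMap.toContinuousLinearMap b.equiv.toLinearMap)
  let N := LinearMap.toContinuousLinearMap (generator c n k ∘ₗ (b.coords hA).toLinearMap)
  let ζ := LinearMap.toContinuousLinearMap (blockDiag c n k ∘ₗ (b.coords hA).toLinearMap)
  have h : b.param hA = fun x => Λ (expConj (N x) (b.diagonal + ζ x)) :=
    funext fun x => (hπ (b.param hA x)).symm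
  rw [h]
  refine ((Λ.hasStrictFDerivAt).comp 0 (hasStrictFDerivAt_expConj N ζ b.diagonal
    (LinearMap.toContinuousLinearMap (b.preDeriv ∘ₗ (b.coords hA).toLinearMap))
    fun x => rfl)).congr_fderiv ?_
  refine ContinuousLinearMap.ext fun x => ?_
  exact hπ (b.deriv hA (b.coords hA x))

/-- Subtracting a scalar commutes with the conjugation, which preserves rank; the invertible lower
block contributes `n - k`. -/
theorem rank_param (b : BlockForm c n k A l) (hA : A ∈ ambient c n)
    (x : ambient c k × (Fin (familyDim c n k) → ℂ)) (μ : ℂ)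
    (h : (b.block + (b.coords hA x).2.1.1 - (l + μ) • 1).det ≠ 0) :
    ((b.param hA x : Matrix (Fin n) (Fin n) ℂ) - (l + μ) • (1 : Matrix (Fin n) (Fin n) ℂ)).rank =
      ((x.1 : Matrix (Fin k) (Fin k) ℂ) - μ • (1 : Matrix (Fin k) (Fin k) ℂ)).rank + (n - k) := by
  have h1 : b.diagonal + blockDiag c n k (b.coords hA x) - (l + μ) • 1 =
      Matrix.fromBlocks (x.1.1 - μ • 1) 0 0 (b.block + (b.coords hA x).2.1.1 - (l + μ) • 1) := by
    change Matrix.fromBlocks _ _ _ _ + Matrix.fromBlocks _ _ _ _ - _ = _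
    rw [← Matrix.fromBlocks_one, Matrix.fromBlocks_smul, Matrix.fromBlocks_add, sub_eq_add_neg,
      Matrix.fromBlocks_neg, Matrix.fromBlocks_add, coords_fst]
    congr 1
    · rw [add_smul]
      abel
    · simp
    · simp
  change (b.equiv _ - _).rank = _
  rw [← b.map_one, ← map_smul, ← map_sub, b.rank_map, ← expConj_sub_smul_one, rank_expConj, h1,
    Matrix.rank_fromBlocks_diagonal, Matrix.rank_of_det_ne_zero h, Fintype.card_fin]

end BlockForm

/-- This one chart serves all three germs. The determinant of the shifted lower block is nonzero at
`(0, 0)`, hence on a product neighbourhood, which gives an `ε` that works uniformly on the source of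
the chart. -/
theorem exists_matrix_chart {c : MatrixCase} {n k : ℕ} (A₀ : ambient c n) {l : ℂ}
    (h : IsStrictEigenvalue (A₀ : Matrix (Fin n) (Fin n) ℂ) l k) :
    ∃ φ : OpenPartialHomeomorph (ambient c k × (Fin (familyDim c n k) → ℂ)) (ambient c n),
      0 ∈ φ.source ∧ φ 0 = A₀ ∧ AnalyticOnNhd ℂ φ φ.source ∧ AnalyticOnNhd ℂ φ.symm φ.target ∧
      ∃ ε > 0, ∀ x ∈ φ.source, ∀ μ : ℂ, ‖μ‖ < ε →
        (((φ x : Matrix (Fin n) (Fin n) ℂ) - (l + μ) • (1 : Matrix (Fin n) (Fin n) ℂ)).rank + 2 ≤ n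
          ↔ ((x.1 : Matrix (Fin k) (Fin k) ℂ) - μ • (1 : Matrix (Fin k) (Fin k) ℂ)).rank + 2
            ≤ k) := by
  obtain ⟨b⟩ := nonempty_blockForm A₀.2 h
  let g : (ambient c k × (Fin (familyDim c n k) → ℂ)) × ℂ → ℂ := fun p =>
    (b.block + (b.coords A₀.2 p.1).2.1.1 - (l + p.2) • 1).det
  have hg : Continuous g := by
    have h1 : Continuous fun x => (b.coords A₀.2 x).2.1.1 :=
      ((ambientOn c (Fin (n - k))).subtype ∘ₗ LinearMap.fst ℂ _ _ ∘ₗ LinearMap.snd ℂ _ _ ∘ₗ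
        (b.coords A₀.2).toLinearMap).continuous_of_finiteDimensional
    refine Continuous.matrix_det ?_
    exact (continuous_const.add (h1.comp continuous_fst)).sub
      ((continuous_const.add continuous_snd).smul continuous_const)
  have hg0 : g (0, 0) ≠ 0 := by
    have : g (0, 0) = (b.block - l • 1).det := by
      simp [g]
    rw [this]
    exact ((Matrix.isUnit_iff_isUnit_det _).1 b.isUnit_block).ne_zero
  obtain ⟨U, hU, V, hV, hUV⟩ := mem_nhds_prod_iff.1
    (hg.continuousAt.eventually_ne hg0 : {p | g p ≠ 0} ∈ 𝓝 (0, 0))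
  obtain ⟨ε, hε, hεV⟩ := Metric.mem_nhds_iff.1 hV
  obtain ⟨φ, h0, hsub, hφ, ha, ha'⟩ := exists_analytic_chart (b.analyticAt_param A₀.2)
    (b.hasStrictFDerivAt_param A₀.2) hU
  refine ⟨φ, h0, ?_, ha, ha', ε, hε, fun x hx μ hμ => ?_⟩
  · exact (congrFun hφ 0).trans (b.param_zero A₀.2)
  · have hx' : g (x, μ) ≠ 0 := hUV ⟨hsub hx, hεV (by simpa using hμ)⟩
    have hk := h.le
    refine Eq.subst (motive := fun M : ambient c n =>
      ((M : Matrix (Fin n) (Fin n) ℂ) - (l + μ) • (1 : Matrix (Fin n) (Fin n) ℂ)).rank + 2 ≤ n ↔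
        ((x.1 : Matrix (Fin k) (Fin k) ℂ) - μ • (1 : Matrix (Fin k) (Fin k) ℂ)).rank + 2 ≤ k)
      (congrFun hφ x).symm ?_
    rw [b.rank_param A₀.2 x μ hx']
    omega

/-! ### The three germs -/

theorem two_le_geomMult_iff {n : ℕ} (A : Matrix (Fin n) (Fin n) ℂ) (l : ℂ) :
    2 ≤ geomMult A l ↔ (A - l • (1 : Matrix (Fin n) (Fin n) ℂ)).rank + 2 ≤ n := by
  have := geomMult_add_rank A l
  omega

theorem germIso_corankTwo {c : MatrixCase} {n k : ℕ} (B₀ : ambient c n)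
    (h : IsStrictEigenvalue (B₀ : Matrix (Fin n) (Fin n) ℂ) 0 k) :
    GermIso (corankTwo c n) B₀
      (corankTwo c k ×ˢ (Set.univ : Set (Fin (familyDim c n k) → ℂ))) 0 := by
  obtain ⟨φ, h0, hφ0, ha, ha', ε, hε, hr⟩ := exists_matrix_chart B₀ h
  refine ⟨φ.symm, hφ0 ▸ φ.map_source h0,
    (congrArg φ.symm hφ0).symm.trans (φ.left_inv h0), ha', ha, ?_⟩
  · refine OpenPartialHomeomorph.IsImage.symm ?_
    intro x hx
    have := hr x hx 0 (by simpa using hε)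
    simp only [add_zero, zero_smul, sub_zero] at this
    exact ⟨fun hx => ⟨this.1 hx, trivial⟩, fun hx => this.2 hx.1⟩

/-- `V` is the preimage of the model under the inverse chart, so the isomorphism is immediate; the
content is that `V` represents the branch. -/
theorem germIso_branch {c : MatrixCase} {n k : ℕ} (A₀ : ambient c n) {l : ℂ}
    (h : IsStrictEigenvalue (A₀ : Matrix (Fin n) (Fin n) ℂ) l k) :
    ∃ V : Set (ambient c n), IsBranch c n A₀ l V ∧
      GermIso V A₀
        (geomDegeneracy c k ×ˢ (Set.univ : Set (Fin (familyDim c n k) → ℂ))) 0 := by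
  obtain ⟨φ, h0, hφ0, ha, ha', ε, hε, hr⟩ := exists_matrix_chart A₀ h
  have hA₀ : A₀ ∈ φ.target := hφ0 ▸ φ.map_source h0
  have hs0 : φ.symm A₀ = 0 := (congrArg φ.symm hφ0).symm.trans (φ.left_inv h0)
  refine ⟨φ.symm ⁻¹' (geomDegeneracy c k ×ˢ Set.univ), ?_, φ.symm, hA₀, hs0, ha', ha,
    fun A _ => Iff.rfl⟩
  -- Inside this neighbourhood the chart is defined and the rank equivalence holds for every
  -- eigenvalue in question.
  refine ⟨φ.target ×ˢ Metric.ball l ε,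
    prod_mem_nhds (φ.open_target.mem_nhds hA₀) (Metric.ball_mem_nhds l hε), ?_⟩
  intro W hW hWsub
  obtain ⟨U, hU, V, hV, hUV⟩ := mem_nhds_prod_iff.1 hW
  obtain ⟨r, hr0, hrV⟩ := Metric.mem_nhds_iff.1 hV
  have hcont : Filter.Tendsto (fun A => (k : ℝ) * ‖((φ.symm A).1 : Matrix (Fin k) (Fin k) ℂ)‖)
      (𝓝 A₀) (𝓝 0) := by
    have h1 : ContinuousAt (fun A => (k : ℝ) * ‖(φ.symm A).1‖) A₀ :=
      continuousAt_const.mul (φ.continuousAt_symm hA₀).fst.norm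
    have h2 : (k : ℝ) * ‖(φ.symm A₀).1‖ = 0 := by simp [hs0]
    have h3 := h1.tendsto
    rw [h2] at h3
    exact h3
  filter_upwards [hU, φ.open_target.mem_nhds hA₀, hcont.eventually_lt_const hr0,
    hcont.eventually_lt_const hε] with A hAU hAt hAr hAε
  have hright := φ.right_inv hAt
  constructor
  -- The eigenvalue `μ` of the upper block is not assumed small; the bound by `k * ‖X‖` puts `(A, l
  -- + μ)` into `W`.
  · rintro ⟨⟨μ, hμ⟩, -⟩
    have hle := norm_le_of_two_le_geomMult hμ
    have hmem : (A, l + μ) ∈ U ×ˢ V := ⟨hAU, hrV (by simpa using hle.trans_lt hAr)⟩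
    refine ⟨(A, l + μ), ⟨?_, hUV hmem⟩, rfl⟩
    have := (hr _ (φ.map_target hAt) μ (hle.trans_lt hAε)).2 ((two_le_geomMult_iff _ _).1 hμ)
    rw [hright] at this
    exact this
  · rintro ⟨⟨A', l'⟩, ⟨hmem, hWmem⟩, rfl⟩
    refine ⟨⟨l' - l, (two_le_geomMult_iff _ _).2 ?_⟩, trivial⟩
    have hl : ‖l' - l‖ < ε := by simpa [dist_eq_norm] using (hWsub hWmem).2
    refine (hr _ (φ.map_target hAt) (l' - l) hl).1 ?_
    rw [hright, add_sub_cancel]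
    exact hmem

/-- The rearrangement of the factors that identifies the parameters of the lifted variety. -/
noncomputable def liftedCoords (E F : Type*) [NormedAddCommGroup E] [NormedSpace ℂ E]
    [NormedAddCommGroup F] [NormedSpace ℂ F] : ((E × ℂ) × F) ≃L[ℂ] ((E × F) × ℂ) :=
  (ContinuousLinearEquiv.prodAssoc ℂ E ℂ F).trans
    ((((ContinuousLinearEquiv.refl ℂ E).prodCongr (ContinuousLinearEquiv.prodComm ℂ ℂ F))).trans
      (ContinuousLinearEquiv.prodAssoc ℂ E F ℂ).symm)

theorem germIso_liftedDegeneracy {c : MatrixCase} {n k : ℕ} (A₀ : ambient c n) {l : ℂ}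
    (h : IsStrictEigenvalue (A₀ : Matrix (Fin n) (Fin n) ℂ) l k) :
    GermIso (liftedDegeneracy c n) (A₀, l)
      (liftedDegeneracy c k ×ˢ (Set.univ : Set (Fin (familyDim c n k) → ℂ))) 0 := by
  obtain ⟨φ, h0, hφ0, ha, ha', ε, hε, hr⟩ := exists_matrix_chart A₀ h
  let e := liftedCoords (ambient c k) (Fin (familyDim c n k) → ℂ)
  -- The eigenvalue coordinate is `l + μ`, restricted to the `μ` for which the rank equivalence is
  -- available.
  let τ : OpenPartialHomeomorph ℂ ℂ :=
    (Homeomorph.addLeft l).toOpenPartialHomeomorph.restrOpen (Metric.ball 0 ε) Metric.isOpen_ball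
  let Φ := e.toHomeomorph.toOpenPartialHomeomorph.trans (φ.prod τ)
  have hsrc : ∀ x, x ∈ Φ.source → (x.1.1, x.2) ∈ φ.source ∧ ‖x.1.2‖ < ε := by
    intro x hx
    have hx' := hx.2
    have h2 : x.1.2 ∈ τ.source := hx'.2
    exact ⟨hx'.1, by simpa using h2.2⟩
  have hΦ : ∀ x, Φ x = (φ (x.1.1, x.2), l + x.1.2) := fun _ => rfl
  have h0' : (0 : (ambient c k × ℂ) × (Fin (familyDim c n k) → ℂ)) ∈ Φ.source :=
    ⟨trivial, h0, trivial, Metric.mem_ball_self hε⟩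
  have hΦ0 : Φ 0 = (A₀, l) := by
    rw [hΦ, ← hφ0]
    exact Prod.ext rfl (add_zero l)
  refine ⟨Φ.symm, hΦ0 ▸ Φ.map_source h0', (congrArg Φ.symm hΦ0).symm.trans (Φ.left_inv h0'), ?_, ?_, ?_⟩
  · intro y hy
    have hy1 : y.1 ∈ φ.target := hy.1.1
    change AnalyticAt ℂ (fun y : ambient c n × ℂ => e.symm (φ.symm y.1, -l + y.2)) y
    refine (e.symm.toContinuousLinearMap.analyticAt _).comp ?_
    exact ((ha' _ hy1).comp (f := Prod.fst) analyticAt_fst).prod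
      (analyticAt_const.add analyticAt_snd)
  · intro x hx
    change AnalyticAt ℂ (fun x : (ambient c k × ℂ) × (Fin (familyDim c n k) → ℂ) =>
      (φ (x.1.1, x.2), l + x.1.2)) x
    have h11 : AnalyticAt ℂ (fun x : (ambient c k × ℂ) × (Fin (familyDim c n k) → ℂ) => x.1.1) x :=
      ((ContinuousLinearMap.fst ℂ _ _).comp (ContinuousLinearMap.fst ℂ _ _)).analyticAt x
    have h12 : AnalyticAt ℂ (fun x : (ambient c k × ℂ) × (Fin (familyDim c n k) → ℂ) => x.1.2) x :=
      ((ContinuousLinearMap.snd ℂ _ _).comp (ContinuousLinearMap.fst ℂ _ _)).analyticAt x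
    exact ((ha _ (hsrc x hx).1).comp (f := fun x : (ambient c k × ℂ) ×
      (Fin (familyDim c n k) → ℂ) => (x.1.1, x.2)) (h11.prod analyticAt_snd)).prod
      (analyticAt_const.add h12)
  · refine OpenPartialHomeomorph.IsImage.symm ?_
    intro x hx
    obtain ⟨hx1, hx2⟩ := hsrc x hx
    have := hr _ hx1 _ hx2
    exact ⟨fun hx => ⟨this.1 hx, trivial⟩, fun hx => this.2 hx.1⟩

theorem corollary2p2 (c : MatrixCase) (n k : ℕ) (hk : 2 ≤ k) :
    (∀ (A₀ : ambient c n) (l₀ : ℂ),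
      A₀ ∈ geomDegeneracy c n →
      IsStrictEigenvalue (A₀ : Matrix (Fin n) (Fin n) ℂ) l₀ k →
        (∃ V : Set (ambient c n), IsBranch c n A₀ l₀ V ∧
          GermIso V A₀
            (geomDegeneracy c k ×ˢ (Set.univ : Set (Fin (familyDim c n k) → ℂ))) 0) ∧
        GermIso (liftedDegeneracy c n) (A₀, l₀)
          (liftedDegeneracy c k ×ˢ (Set.univ : Set (Fin (familyDim c n k) → ℂ))) 0) ∧
    (∀ B₀ : ambient c n,
      B₀ ∈ corankTwo c n →
      IsStrictEigenvalue (B₀ : Matrix (Fin n) (Fin n) ℂ) 0 k →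
        GermIso (corankTwo c n) B₀
          (corankTwo c k ×ˢ (Set.univ : Set (Fin (familyDim c n k) → ℂ))) 0) ∧
    familyDim .general n k = n ^ 2 - k ^ 2 ∧
    familyDim .sym n k = (n + 1).choose 2 - (k + 1).choose 2 ∧
    familyDim .diag n k = n - k := by
  refine ⟨fun A₀ l₀ _ h => ⟨germIso_branch A₀ h, germIso_liftedDegeneracy A₀ h⟩,
    fun B₀ _ h => germIso_corankTwo B₀ h, ?_, ?_, ?_⟩
  · rw [familyDim, finrank_ambient_general, finrank_ambient_general]
  · rw [familyDim, finrank_ambient_sym, finrank_ambient_sym]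
  · rw [familyDim, finrank_ambient_diag, finrank_ambient_diag]
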